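/- Let $\nu:\mathbb N\to\mathbb C$, where $\mathbb N=\{1,2,3,\dots\}$, be a multiplicative function, i.e. $\nu(1)=1$ and $\nu(mn)=\nu(m)\nu(n)$ whenever $\gcd(m,n)=1$, and assume that $|\nu(n)|\le 1$ for all $n\ge 1$. Let $1=b_1<b_2<b_3<\cdots$ be an increasing sequence of integers with $b_{k+1}-b_k\to\infty$ as $k\to\infty$, and let $P\in\mathbb R[x]$ be a nonconstant polynomial whose leading coefficient is irrational. Then $$\frac{1}{b_{K+1}}\sum_{1\le k\le K}\Bigl|\sum_{b_k\le n<b_{k+1}}e^{2\pi i P(n)}\,\nu(n)\Bigr|\longrightarrow 0\qquad\text{as }K\to\infty.$$ -/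

import Mathlib

open Finset Filter Topology

/-! Let `s k` be the sum over the `k`-th block and choose `c k` in the closed unit disc with `c k *
s k = ‖s k‖`. Spreading `c` over the blocks gives a bounded weight `w`, and the sum of the absolute
values becomes one sum of `F n * ν n` with `F n = w n * phase (P.eval n)`. It must be shown that
this sum is `o(N)`.

By `katai_criterion` it suffices that, for distinct primes `p` and `q`, the correlations of `F (p *
m)` with `F (q * m)` average to zero. This condition does not involve `ν`, except through `w`, of
which only the bound and slow variation matter.

The phase of the correlation is `P(px) - P(qx)`, whose leading coefficient `(p^d - q^d)α` is
irrational. By `weyl_sum_le` its sums over windows of a fixed large length are uniformly small.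
Since the gaps tend to infinity, `w (p * m)` and the conjugate of `w (q * m)` are constant on most
such windows, so they do not spoil the cancellation (`SlowlyVarying.tendsto_sum_mul_phase`). -/

/-- The additive character `x ↦ e^{2πix}` of the real line. -/
noncomputable def phase (x : ℝ) : ℂ := Complex.exp (2 * (Real.pi : ℂ) * Complex.I * (x : ℂ))

lemma phase_add (x y : ℝ) : phase (x + y) = phase x * phase y := by
  simp only [phase, ← Complex.exp_add]
  push_cast
  ring_nf

lemma norm_phase (x : ℝ) : ‖phase x‖ = 1 := by
  have : (2 * (Real.pi : ℂ) * Complex.I * (x : ℂ)) = ((2 * Real.pi * x : ℝ) : ℂ) * Complex.I := by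
    push_cast; ring
  rw [phase, this, Complex.norm_exp_ofReal_mul_I]

lemma conj_phase (x : ℝ) : (starRingEnd ℂ) (phase x) = phase (-x) := by
  simp [phase, ← Complex.exp_conj, Complex.conj_ofNat]

lemma phase_mul_conj_phase (x y : ℝ) : phase x * (starRingEnd ℂ) (phase y) = phase (x - y) := by
  rw [conj_phase, ← phase_add, sub_eq_add_neg]

lemma phase_natCast_mul (n : ℕ) (x : ℝ) : phase (n * x) = phase x ^ n := by
  rw [phase, phase, ← Complex.exp_nat_mul]
  push_cast
  ring_nf

lemma phase_ne_one_of_irrational {x : ℝ} (hx : Irrational x) : phase x ≠ 1 := by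
  intro h
  obtain ⟨n, hn⟩ := Complex.exp_eq_one_iff.mp h
  have h2 : (2 * (Real.pi : ℂ) * Complex.I) ≠ 0 := Complex.two_pi_I_ne_zero
  have h3 : (x : ℂ) = n := by
    apply mul_left_cancel₀ h2
    rw [hn]; ring
  exact hx.ne_int n (by exact_mod_cast h3)

/-! ### Window shifts and van der Corput's inequality. -/

/-- A sum over a window of length `N` changes by at most `2h` when the window is shifted by `h`. -/
lemma norm_sum_range_shift_sub_le {u : ℕ → ℂ} (hu : ∀ n, ‖u n‖ ≤ 1) (N h : ℕ) :
    ‖∑ n ∈ range N, u n - ∑ n ∈ range N, u (n + h)‖ ≤ 2 * h := by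
  have h1 := sum_range_add u N h
  have h2 := sum_range_add u h N
  rw [add_comm h N, h1] at h2
  have h3 : ∑ n ∈ range N, u n - ∑ n ∈ range N, u (n + h) =
      ∑ x ∈ range h, u x - ∑ x ∈ range h, u (N + x) := by
    simp only [add_comm _ h]
    linear_combination h2
  rw [h3]
  have bound : ∀ v : ℕ → ℂ, (∀ n, ‖v n‖ ≤ 1) → ‖∑ x ∈ range h, v x‖ ≤ h := fun v hv => by
    simpa using norm_sum_le_of_le (range h) (fun i _ => hv i)
  calc _ ≤ _ := norm_sub_le _ _
    _ ≤ h + h := add_le_add (bound _ hu) (bound _ fun n => hu _)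
    _ = 2 * h := by ring

/-- Averaging a sum over the `H` first shifts of its window costs at most `2H²`. -/
lemma mul_norm_sum_range_le {u : ℕ → ℂ} (hu : ∀ n, ‖u n‖ ≤ 1) (N H : ℕ) :
    H * ‖∑ n ∈ range N, u n‖ ≤ ‖∑ n ∈ range N, ∑ h ∈ range H, u (n + h)‖ + 2 * (H : ℝ) ^ 2 := by
  rw [sum_comm]
  have h1 : ‖∑ h ∈ range H, (∑ n ∈ range N, u n - ∑ n ∈ range N, u (n + h))‖ ≤
      2 * (H : ℝ) ^ 2 := by
    refine (norm_sum_le_of_le (range H) (fun h _ => norm_sum_range_shift_sub_le hu N h)).trans ?_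
    calc ∑ h ∈ range H, (2 * h : ℝ) ≤ ∑ h ∈ range H, (2 * H : ℝ) := by
          refine sum_le_sum fun i hi => ?_
          have : (i : ℝ) ≤ H := by exact_mod_cast (mem_range.mp hi).le
          linarith
      _ = _ := by simp; ring
  rw [sum_sub_distrib, sum_const, card_range, nsmul_eq_mul] at h1
  have h2 := norm_sub_norm_le (H * ∑ n ∈ range N, u n)
    (∑ h ∈ range H, ∑ n ∈ range N, u (n + h))
  rw [norm_mul, Complex.norm_natCast] at h2
  linarith

lemma norm_sum_sq_le_card_mul {ι : Type*} (s : Finset ι) (f : ι → ℂ) :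
    ‖∑ i ∈ s, f i‖ ^ 2 ≤ #s * ∑ i ∈ s, ‖f i‖ ^ 2 :=
  (pow_le_pow_left₀ (norm_nonneg _) (norm_sum_le _ _) 2).trans sq_sum_le_card_mul_sum_sq

/-- Expanding the square: a mean square of sums is controlled by the correlations. -/
lemma sum_norm_sum_sq_le {ι κ : Type*} (s : Finset ι) (t : Finset κ) (f : ι → κ → ℂ) :
    ∑ i ∈ s, ‖∑ k ∈ t, f i k‖ ^ 2 ≤
      ∑ k ∈ t, ∑ l ∈ t, ‖∑ i ∈ s, f i k * (starRingEnd ℂ) (f i l)‖ := by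
  have h1 : ((∑ i ∈ s, ‖∑ k ∈ t, f i k‖ ^ 2 : ℝ) : ℂ) =
      ∑ k ∈ t, ∑ l ∈ t, ∑ i ∈ s, f i k * (starRingEnd ℂ) (f i l) := by
    push_cast
    simp_rw [← Complex.mul_conj', map_sum, sum_mul_sum]
    rw [sum_comm]
    exact sum_congr rfl fun k _ => sum_comm
  have h2 : ∑ i ∈ s, ‖∑ k ∈ t, f i k‖ ^ 2 = ‖((∑ i ∈ s, ‖∑ k ∈ t, f i k‖ ^ 2 : ℝ) : ℂ)‖ := by
    rw [Complex.norm_real, Real.norm_of_nonneg (by positivity)]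
  rw [h2, h1]
  exact norm_sum_le_of_le _ fun k _ => norm_sum_le _ _

/-- A form of van der Corput's inequality. -/
lemma van_der_corput {u : ℕ → ℂ} (hu : ∀ n, ‖u n‖ ≤ 1) {N H : ℕ} {δ : ℝ}
    (hδ : ∀ h < H, ∀ k < H, h ≠ k →
      ‖∑ n ∈ range N, u (n + h) * (starRingEnd ℂ) (u (n + k))‖ ≤ δ * N) (hδ0 : 0 ≤ δ) :
    H * ‖∑ n ∈ range N, u n‖ ≤ N * √(H + δ * H ^ 2) + 2 * (H : ℝ) ^ 2 := by
  refine (mul_norm_sum_range_le hu N H).trans (add_le_add_left ?_ _)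
  have h1 := norm_sum_sq_le_card_mul (range N) (fun n => ∑ h ∈ range H, u (n + h))
  have h2 := sum_norm_sum_sq_le (range N) (range H) (fun n h => u (n + h))
  -- The diagonal contributes at most `N` per shift. The term `δ * N` is allowed on the diagonal as
  -- well, so that the double sum is evaluated without splitting.
  have h3 : ∑ k ∈ range H, ∑ l ∈ range H,
      ‖∑ i ∈ range N, u (i + k) * (starRingEnd ℂ) (u (i + l))‖ ≤
      ∑ k ∈ range H, ∑ l ∈ range H, ((if k = l then (N : ℝ) else 0) + δ * N) := by
    refine sum_le_sum fun k hk => sum_le_sum fun l hl => ?_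
    split_ifs with h
    · subst h
      have : ‖∑ i ∈ range N, u (i + k) * (starRingEnd ℂ) (u (i + k))‖ ≤ ∑ i ∈ range N, (1 : ℝ) := by
        refine norm_sum_le_of_le _ fun i _ => ?_
        rw [norm_mul, RCLike.norm_conj]
        exact mul_le_one₀ (hu _) (norm_nonneg _) (hu _)
      have h0 : 0 ≤ δ * N := by positivity
      simp at this
      simp
      linarith
    · simpa using hδ k (mem_range.mp hk) l (mem_range.mp hl) h
  have h4 : ∑ k ∈ range H, ∑ l ∈ range H, ((if k = l then (N : ℝ) else 0) + δ * N) =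
      N * (H + δ * H ^ 2) := by
    have : ∀ k ∈ range H, ∑ l ∈ range H, ((if k = l then (N : ℝ) else 0) + δ * N) =
        N + H * (δ * N) := fun k hk => by
      rw [sum_add_distrib, sum_ite_eq, if_pos hk]; simp
    rw [sum_congr rfl this]
    simp
    ring
  rw [card_range] at h1
  refine abs_le_of_sq_le_sq' ?_ (by positivity) |>.2
  rw [mul_pow, Real.sq_sqrt (by positivity)]
  calc _ ≤ _ := h1
    _ ≤ N * (N * (H + δ * H ^ 2)) := by
      gcongr
      linarith
    _ = _ := by ring

/-! ### Iterated differences and Weyl sums. -/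

lemma fwdDiff_iter_natCast_add {f : ℝ → ℝ} {β : ℝ} {d : ℕ} (hf : ∀ x, (fwdDiff 1)^[d + 1] f x = β)
    (h : ℕ) (x : ℝ) : (fwdDiff 1)^[d] f (x + h) = (fwdDiff 1)^[d] f x + h * β := by
  induction h with
  | zero => simp
  | succ h ih =>
    have := hf (x + h)
    rw [Function.iterate_succ_apply', fwdDiff] at this
    push_cast
    rw [← add_assoc]
    linarith

/-- Differencing lowers the degree by one and multiplies the top difference by `h - k`; for `h ≠ k`
irrationality survives, which drives the induction in `weyl_sum_le`. -/
lemma fwdDiff_iter_shift_sub_shift {f : ℝ → ℝ} {β : ℝ} {d : ℕ}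
    (hf : ∀ x, (fwdDiff 1)^[d + 1] f x = β) (h k : ℕ) (x : ℝ) :
    (fwdDiff 1)^[d] (fun y => f (y + h) - f (y + k)) x = (((h : ℤ) - (k : ℤ) : ℤ) : ℝ) * β := by
  have : (fun y => f (y + h) - f (y + k)) =
      (fun y => f (y + h)) + (-1 : ℝ) • (fun y => f (y + k)) := by
    ext y; simp [sub_eq_add_neg]
  rw [this, fwdDiff_iter_add, fwdDiff_iter_const_smul]
  simp only [Pi.add_apply, Pi.smul_apply, fwdDiff_iter_comp_add, fwdDiff_iter_natCast_add hf]
  push_cast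
  simp
  ring

/-- Weyl's theorem, uniform over all phases whose `(d+1)`-st difference is a given irrational
constant. -/
theorem weyl_sum_le (d : ℕ) : ∀ {β : ℝ}, Irrational β → ∀ {ε : ℝ}, 0 < ε → ∃ L₀ : ℕ, ∀ L ≥ L₀,
    ∀ f : ℝ → ℝ, (∀ x, (fwdDiff 1)^[d + 1] f x = β) → ‖∑ n ∈ range L, phase (f n)‖ ≤ ε * L := by
  induction d with
  | zero =>
    intro β hβ ε hε
    -- With `d = 0` the sum is geometric with ratio `phase β ≠ 1`, hence bounded independently of
    -- `L` and `f`.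
    have hz : 0 < ‖phase β - 1‖ := norm_pos_iff.mpr (sub_ne_zero.mpr (phase_ne_one_of_irrational hβ))
    obtain ⟨L₀, hL₀⟩ := exists_nat_ge (2 / ‖phase β - 1‖ / ε)
    refine ⟨L₀, fun L hL f hf => ?_⟩
    have hfn : ∀ n : ℕ, phase (f n) = phase (f 0) * phase β ^ n := fun n => by
      have := fwdDiff_iter_natCast_add hf n 0
      simp only [Function.iterate_zero, id, zero_add] at this
      rw [this, phase_add, phase_natCast_mul]
    simp_rw [hfn]
    rw [← mul_sum, norm_mul, norm_phase, one_mul, geom_sum_eq (phase_ne_one_of_irrational hβ),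
      norm_div]
    have h1 : ‖phase β ^ L - 1‖ ≤ 2 := by
      refine (norm_sub_le _ _).trans ?_
      rw [norm_pow, norm_phase]
      norm_num
    have h2 : 2 / ‖phase β - 1‖ ≤ ε * L := by
      rw [div_le_iff₀ hε] at hL₀
      have : (L₀ : ℝ) ≤ L := by exact_mod_cast hL
      nlinarith
    exact (div_le_div_of_nonneg_right h1 hz.le).trans h2
  | succ d ih =>
    intro β hβ ε hε
    -- These choices give `H ≤ δ * H ^ 2`, so `H + δ * H ^ 2 ≤ (ε * H / 2) ^ 2`; taking `L ≥ 4 * H /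
    -- ε` below makes the shift error `2 * H ^ 2` at most `H * (ε * L) / 2`.
    obtain ⟨H, hH⟩ := exists_nat_gt (8 / ε ^ 2)
    have hHpos : (0 : ℝ) < H := lt_trans (by positivity) hH
    set δ : ℝ := ε ^ 2 / 8 with hδ
    have hδ0 : 0 < δ := by positivity
    have key : ∀ h k : ℕ, ∃ L₀ : ℕ, h ≠ k → ∀ L ≥ L₀, ∀ f : ℝ → ℝ,
        (∀ x, (fwdDiff 1)^[d + 1 + 1] f x = β) →
        ‖∑ n ∈ range L, phase (f (n + h) - f (n + k))‖ ≤ δ * L := by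
      intro h k
      by_cases hk : h = k
      · exact ⟨0, fun h => absurd hk h⟩
      have hirr : Irrational ((((h : ℤ) - (k : ℤ) : ℤ) : ℝ) * β) :=
        hβ.intCast_mul (by omega)
      obtain ⟨L₀, hL₀⟩ := ih hirr hδ0
      exact ⟨L₀, fun _ L hL f hf => hL₀ L hL (fun y => f (y + h) - f (y + k))
        (fwdDiff_iter_shift_sub_shift hf h k)⟩
    choose L₀ hL₀ using key
    obtain ⟨M, hM⟩ := exists_nat_ge (4 * H / ε)
    refine ⟨M + ∑ h ∈ range H, ∑ k ∈ range H, L₀ h k, fun L hL f hf => ?_⟩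
    have hcorr : ∀ h < H, ∀ k < H, h ≠ k → ‖∑ n ∈ range L,
        phase (f (n + h : ℕ)) * (starRingEnd ℂ) (phase (f (n + k : ℕ)))‖ ≤ δ * L := by
      intro h hh k hk hne
      simp_rw [phase_mul_conj_phase]
      push_cast
      refine hL₀ h k hne L ?_ f hf
      have h1 : L₀ h k ≤ ∑ k ∈ range H, L₀ h k :=
        single_le_sum (f := fun k => L₀ h k) (fun _ _ => Nat.zero_le _) (mem_range.mpr hk)
      have h2 : ∑ k ∈ range H, L₀ h k ≤ ∑ h ∈ range H, ∑ k ∈ range H, L₀ h k :=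
        single_le_sum (f := fun h => ∑ k ∈ range H, L₀ h k) (fun _ _ => Nat.zero_le _)
          (mem_range.mpr hh)
      omega
    have hvdc := van_der_corput (u := fun n => phase (f n)) (fun n => (norm_phase _).le)
      hcorr hδ0.le
    have hsqrt : √(H + δ * H ^ 2) ≤ ε / 2 * H := by
      rw [Real.sqrt_le_left (by positivity)]
      rw [div_lt_iff₀ (by positivity)] at hH
      have : (H : ℝ) ≤ δ * H ^ 2 := by
        rw [hδ]; nlinarith
      have h3 : (ε / 2 * H) ^ 2 = 2 * (δ * (H : ℝ) ^ 2) := by rw [hδ]; ring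
      linarith
    have hLM : (M : ℝ) ≤ L := by exact_mod_cast le_trans (Nat.le_add_right _ _) hL
    rw [div_le_iff₀ hε] at hM
    have h5 : (L : ℝ) * √(H + δ * H ^ 2) ≤ L * (ε / 2 * H) := by gcongr
    have h6 : (4 * H : ℝ) ≤ L * ε := by nlinarith
    have h7 : (H : ℝ) * ‖∑ n ∈ range L, phase (f n)‖ ≤ H * (ε * L) := by nlinarith
    exact le_of_mul_le_mul_left h7 hHpos

/-! ### The Turán–Kubilius inequality. -/

lemma card_filter_dvd_le (N d : ℕ) : (#{n ∈ Ioc 0 N | d ∣ n} : ℝ) ≤ N / d := by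
  rw [Nat.Ioc_filter_dvd_card_eq_div]
  exact Nat.cast_div_le

lemma le_card_filter_dvd (N d : ℕ) : (N : ℝ) / d - 1 ≤ #{n ∈ Ioc 0 N | d ∣ n} := by
  rw [Nat.Ioc_filter_dvd_card_eq_div]
  have h := Nat.lt_floor_add_one ((N : ℝ) / d)
  rw [Nat.floor_div_eq_div] at h
  linarith

/-- The Turán–Kubilius inequality for a finite set `S` of primes. -/
lemma turan_kubilius (S : Finset ℕ) (hS : ∀ p ∈ S, p.Prime) (N : ℕ) :
    ∑ n ∈ Ioc 0 N, ((#{p ∈ S | p ∣ n} : ℝ) - ∑ p ∈ S, (1 / p : ℝ)) ^ 2 ≤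
      N * ∑ p ∈ S, (1 / p : ℝ) + 2 * #S * ∑ p ∈ S, (1 / p : ℝ) := by
  set A := ∑ p ∈ S, (1 / p : ℝ) with hA
  have hA0 : 0 ≤ A := sum_nonneg fun p _ => by positivity
  have hω : ∀ n, (#{p ∈ S | p ∣ n} : ℝ) = ∑ p ∈ S, if p ∣ n then 1 else 0 := fun n => by simp
  have h1 : (N : ℝ) * A - #S ≤ ∑ n ∈ Ioc 0 N, (#{p ∈ S | p ∣ n} : ℝ) := by
    simp_rw [hω]
    rw [sum_comm]
    calc (N : ℝ) * A - #S = ∑ p ∈ S, ((N : ℝ) / p - 1) := by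
          rw [sum_sub_distrib, hA, mul_sum]
          simp [div_eq_mul_inv]
      _ ≤ _ := sum_le_sum fun p _ => by
          rw [sum_boole]; exact le_card_filter_dvd N p
  have h2 : ∑ n ∈ Ioc 0 N, (#{p ∈ S | p ∣ n} : ℝ) ^ 2 ≤ N * A + N * A ^ 2 := by
    simp_rw [hω, sq, sum_mul_sum]
    rw [sum_comm]
    have : ∀ p ∈ S, ∑ n ∈ Ioc 0 N, ∑ q ∈ S,
        ((if p ∣ n then (1 : ℝ) else 0) * if q ∣ n then 1 else 0) ≤
        N / p + ∑ q ∈ S, (N : ℝ) * (1 / p * (1 / q)) := by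
      intro p hp
      rw [sum_comm]
      calc _ ≤ ∑ q ∈ S, ((if p = q then (N : ℝ) / p else 0) + (N : ℝ) * (1 / p * (1 / q))) := by
            refine sum_le_sum fun q hq => ?_
            have hpos : (0 : ℝ) ≤ (N : ℝ) * (1 / p * (1 / q)) := by positivity
            simp_rw [ite_zero_mul_ite_zero, one_mul]
            rw [sum_boole]
            split_ifs with h
            · subst h
              simp only [and_self]
              linarith [card_filter_dvd_le N p]
            · have hco : p.Coprime q := (Nat.coprime_primes (hS p hp) (hS q hq)).mpr h
              have h3 : {n ∈ Ioc 0 N | p ∣ n ∧ q ∣ n} = {n ∈ Ioc 0 N | p * q ∣ n} := by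
                ext n
                simp only [mem_filter, and_congr_right_iff]
                exact fun _ => ⟨fun h => hco.mul_dvd_of_dvd_of_dvd h.1 h.2,
                  fun h => ⟨dvd_of_mul_right_dvd h, dvd_of_mul_left_dvd h⟩⟩
              rw [h3, zero_add]
              refine (card_filter_dvd_le N (p * q)).trans (le_of_eq ?_)
              push_cast
              rw [one_div_mul_one_div, mul_one_div]
        _ = _ := by rw [sum_add_distrib, sum_ite_eq, if_pos hp]
    refine (sum_le_sum this).trans (le_of_eq ?_)
    rw [sum_add_distrib]
    congr 1
    · rw [hA, mul_sum]; simp [div_eq_mul_inv]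
    · simp_rw [← mul_sum, ← sum_mul]
      rw [← hA]
  have h3 : ∑ n ∈ Ioc 0 N, ((#{p ∈ S | p ∣ n} : ℝ) - A) ^ 2 =
      ∑ n ∈ Ioc 0 N, (#{p ∈ S | p ∣ n} : ℝ) ^ 2 -
        2 * A * ∑ n ∈ Ioc 0 N, (#{p ∈ S | p ∣ n} : ℝ) + N * A ^ 2 := by
    simp_rw [sub_sq]
    rw [sum_add_distrib, sum_sub_distrib, mul_sum]
    simp only [sum_const, Nat.card_Ioc, tsub_zero, nsmul_eq_mul]
    congr 2
    exact sum_congr rfl fun n _ => by ring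
  rw [h3]
  -- The second moment is at most `N * A + N * A ^ 2` and the first at least `N * A - #S`; the terms
  -- in `N * A ^ 2` cancel.
  nlinarith

/-! ### Kátai's orthogonality criterion. -/

lemma sum_filter_dvd_eq {E : Type*} [AddCommMonoid E] {p : ℕ} (hp : 0 < p) (N : ℕ) (h : ℕ → E) :
    ∑ n ∈ Ioc 0 N with p ∣ n, h n = ∑ m ∈ Ioc 0 N with p * m ≤ N, h (p * m) := by
  symm
  refine sum_bij (fun m _ => p * m) ?_ ?_ ?_ ?_
  · intro m hm
    simp only [mem_filter, mem_Ioc] at hm ⊢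
    exact ⟨⟨Nat.mul_pos hp hm.1.1, hm.2⟩, dvd_mul_right _ _⟩
  · intro m _ n _ h
    exact Nat.eq_of_mul_eq_mul_left hp h
  · intro n hn
    simp only [mem_filter, mem_Ioc] at hn
    obtain ⟨⟨h0, hN⟩, m, rfl⟩ := hn
    refine ⟨m, ?_, rfl⟩
    simp only [mem_filter, mem_Ioc]
    exact ⟨⟨Nat.pos_of_mul_pos_left h0, (Nat.le_mul_of_pos_left m hp).trans hN⟩, hN⟩
  · intro _ _; rfl

lemma filter_mul_le_eq {p : ℕ} (hp : 0 < p) (N : ℕ) :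
    {m ∈ Ioc 0 N | p * m ≤ N} = Ioc 0 (N / p) := by
  ext m
  simp only [mem_filter, mem_Ioc, Nat.le_div_iff_mul_le hp, mul_comm m p]
  exact ⟨fun h => ⟨h.1.1, h.2⟩, fun h => ⟨⟨h.1, (Nat.le_mul_of_pos_left m hp).trans h.2⟩, h.2⟩⟩

lemma filter_mul_le_and_eq {p q : ℕ} (hp : 0 < p) (N : ℕ) :
    {m ∈ Ioc 0 N | p * m ≤ N ∧ q * m ≤ N} = Ioc 0 (N / max p q) := by
  rw [← filter_mul_le_eq (lt_max_of_lt_left hp)]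
  ext m
  simp only [mem_filter, max_mul_of_nonneg p q (Nat.zero_le m), max_le_iff]

/-- Replacing `ν (p m)` by `ν p ν m` costs at most `2 N / p²`. -/
lemma norm_sum_multiples_sub_le {ν F : ℕ → ℂ}
    (hmul : ∀ m n : ℕ, m.Coprime n → ν (m * n) = ν m * ν n) (hν : ∀ n, ‖ν n‖ ≤ 1)
    (hF : ∀ n, ‖F n‖ ≤ 1) {p : ℕ} (hp : p.Prime) (N : ℕ) :
    ‖∑ n ∈ Ioc 0 N with p ∣ n, F n * ν n -
      ∑ m ∈ Ioc 0 N with p * m ≤ N, ν m * (ν p * F (p * m))‖ ≤ 2 * N * (1 / (p : ℝ) ^ 2) := by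
  rw [sum_filter_dvd_eq hp.pos, ← sum_sub_distrib, filter_mul_le_eq hp.pos]
  -- Multiplicativity makes the two terms agree unless `p ∣ m`, and at most `N / p ^ 2` values of
  -- `m` are such exceptions.
  have h1 : ∀ m ∈ Ioc 0 (N / p),
      ‖F (p * m) * ν (p * m) - ν m * (ν p * F (p * m))‖ ≤ if p ∣ m then 2 else 0 := by
    intro m _
    split_ifs with h
    · refine (norm_sub_le _ _).trans ?_
      have h1 : ‖F (p * m) * ν (p * m)‖ ≤ 1 := by
        rw [norm_mul]; exact mul_le_one₀ (hF _) (norm_nonneg _) (hν _)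
      have h2 : ‖ν m * (ν p * F (p * m))‖ ≤ 1 := by
        rw [norm_mul, norm_mul]
        exact mul_le_one₀ (hν _) (by positivity) (mul_le_one₀ (hν _) (norm_nonneg _) (hF _))
      linarith
    · rw [hmul p m ((Nat.Prime.coprime_iff_not_dvd hp).mpr h)]
      rw [show F (p * m) * (ν p * ν m) - ν m * (ν p * F (p * m)) = 0 by ring, norm_zero]
  refine (norm_sum_le_of_le _ h1).trans ?_
  rw [← sum_filter, sum_const, nsmul_eq_mul]
  have h2 := card_filter_dvd_le (N / p) p
  have h3 : ((N / p : ℕ) : ℝ) ≤ N / p := Nat.cast_div_le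
  have hp0 : (0 : ℝ) < p := by exact_mod_cast hp.pos
  have h4 : ((N / p : ℕ) : ℝ) / p ≤ N / p / p := by gcongr
  have h5 : (N : ℝ) / p / p = N * (1 / (p : ℝ) ^ 2) := by field_simp
  linarith

/-- Cauchy–Schwarz in `m` eliminates `ν m`. Expanding the square over pairs of primes leaves a
diagonal of size `N / p` and the correlations of `F`, with `ν p` and `ν q` as bounded constants.
Writing the condition as `p * m ≤ N` gives all primes the same range of `m`, so the sums can be
interchanged. -/
lemma norm_bilinear_sum_le {ν F : ℕ → ℂ} (hν : ∀ n, ‖ν n‖ ≤ 1)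
    (hF : ∀ n, ‖F n‖ ≤ 1) (S : Finset ℕ) (hS : ∀ p ∈ S, p.Prime) (N : ℕ) :
    ‖∑ p ∈ S, ∑ m ∈ Ioc 0 N with p * m ≤ N, ν m * (ν p * F (p * m))‖ ^ 2 ≤
      N * (N * ∑ p ∈ S, (1 / p : ℝ) + ∑ p ∈ S, ∑ q ∈ S with p ≠ q,
        ‖∑ m ∈ Ioc 0 (N / max p q), F (p * m) * (starRingEnd ℂ) (F (q * m))‖) := by
  simp_rw [sum_filter (fun m => _ ≤ N)]
  rw [sum_comm]
  have h1 := norm_sum_sq_le_card_mul (Ioc 0 N)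
    (fun m => ∑ p ∈ S, if p * m ≤ N then ν m * (ν p * F (p * m)) else 0)
  rw [Nat.card_Ioc, tsub_zero] at h1
  refine h1.trans (mul_le_mul_of_nonneg_left ?_ (Nat.cast_nonneg _))
  have h2 : ∀ m ∈ Ioc 0 N, ‖∑ p ∈ S, if p * m ≤ N then ν m * (ν p * F (p * m)) else 0‖ ^ 2 ≤
      ‖∑ p ∈ S, if p * m ≤ N then ν p * F (p * m) else 0‖ ^ 2 := by
    intro m _
    gcongr
    rw [show (∑ p ∈ S, if p * m ≤ N then ν m * (ν p * F (p * m)) else 0) =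
      ν m * ∑ p ∈ S, if p * m ≤ N then ν p * F (p * m) else 0 by
        rw [mul_sum]; exact sum_congr rfl fun p _ => by split_ifs <;> simp, norm_mul]
    exact mul_le_of_le_one_left (norm_nonneg _) (hν m)
  refine (sum_le_sum h2).trans ((sum_norm_sum_sq_le _ _ _).trans ?_)
  have h3 : ∀ p ∈ S, ∀ q ∈ S, ‖∑ m ∈ Ioc 0 N, (if p * m ≤ N then ν p * F (p * m) else 0) *
      (starRingEnd ℂ) (if q * m ≤ N then ν q * F (q * m) else 0)‖ ≤
      ‖∑ m ∈ Ioc 0 (N / max p q), F (p * m) * (starRingEnd ℂ) (F (q * m))‖ := by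
    intro p hp q hq
    have : ∀ m, (if p * m ≤ N then ν p * F (p * m) else 0) *
        (starRingEnd ℂ) (if q * m ≤ N then ν q * F (q * m) else 0) =
        if p * m ≤ N ∧ q * m ≤ N then ν p * (starRingEnd ℂ) (ν q) *
          (F (p * m) * (starRingEnd ℂ) (F (q * m))) else 0 := by
      intro m
      by_cases h : p * m ≤ N <;> by_cases h' : q * m ≤ N <;> simp [h, h']
      ring
    simp_rw [this]
    rw [← sum_filter, filter_mul_le_and_eq (hS p hp).pos, ← mul_sum, norm_mul, norm_mul,
      RCLike.norm_conj]
    exact mul_le_of_le_one_left (norm_nonneg _) (mul_le_one₀ (hν _) (norm_nonneg _) (hν _))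
  rw [mul_sum, ← sum_add_distrib]
  refine sum_le_sum fun p hp => (sum_le_sum (h3 p hp)).trans ?_
  rw [← sum_filter_add_sum_filter_not S (fun q => p = q), Finset.filter_eq, if_pos hp, sum_singleton,
    max_self]
  refine add_le_add_left ?_ _
  have h4 : ‖∑ m ∈ Ioc 0 (N / p), F (p * m) * (starRingEnd ℂ) (F (p * m))‖ ≤
      ∑ m ∈ Ioc 0 (N / p), (1 : ℝ) := by
    refine norm_sum_le_of_le _ fun i _ => ?_
    rw [norm_mul, RCLike.norm_conj]
    exact mul_le_one₀ (hF _) (norm_nonneg _) (hF _)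
  simp only [sum_const, Nat.card_Ioc, tsub_zero, nsmul_eq_mul, mul_one] at h4
  rw [mul_one_div]
  exact h4.trans Nat.cast_div_le

/-- The finite form of Kátai's inequality. -/
lemma katai_inequality {ν F : ℕ → ℂ}
    (hmul : ∀ m n : ℕ, m.Coprime n → ν (m * n) = ν m * ν n) (hν : ∀ n, ‖ν n‖ ≤ 1)
    (hF : ∀ n, ‖F n‖ ≤ 1) (S : Finset ℕ) (hS : ∀ p ∈ S, p.Prime) (N : ℕ) :
    (∑ p ∈ S, (1 / p : ℝ)) * ‖∑ n ∈ Ioc 0 N, F n * ν n‖ ≤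
      √(N * (N * ∑ p ∈ S, (1 / p : ℝ) + 2 * #S * ∑ p ∈ S, (1 / p : ℝ))) +
      2 * N * ∑ p ∈ S, (1 / (p : ℝ) ^ 2) +
      √(N * (N * ∑ p ∈ S, (1 / p : ℝ) + ∑ p ∈ S, ∑ q ∈ S with p ≠ q,
        ‖∑ m ∈ Ioc 0 (N / max p q), F (p * m) * (starRingEnd ℂ) (F (q * m))‖)) := by
  have hT := Real.le_sqrt_of_sq_le (norm_bilinear_sum_le hν hF S hS N)
  set T := ∑ p ∈ S, ∑ m ∈ Ioc 0 N with p * m ≤ N, ν m * (ν p * F (p * m)) with hTdef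
  set A := ∑ p ∈ S, (1 / p : ℝ) with hA
  have hA0 : 0 ≤ A := sum_nonneg fun p _ => by positivity
  have h1 : ∑ n ∈ Ioc 0 N, ((#{p ∈ S | p ∣ n} : ℝ) : ℂ) * (F n * ν n) =
      ∑ p ∈ S, ∑ n ∈ Ioc 0 N with p ∣ n, F n * ν n := by
    simp_rw [sum_filter]
    rw [sum_comm]
    refine sum_congr rfl fun n _ => ?_
    rw [← sum_filter, sum_const, nsmul_eq_mul]
    simp
  have h2 : ‖∑ p ∈ S, ∑ n ∈ Ioc 0 N with p ∣ n, F n * ν n - T‖ ≤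
      2 * N * ∑ p ∈ S, (1 / (p : ℝ) ^ 2) := by
    rw [hTdef, ← sum_sub_distrib, mul_sum]
    exact norm_sum_le_of_le _ fun p hp => norm_sum_multiples_sub_le hmul hν hF (hS p hp) N
  have h3 : ‖∑ n ∈ Ioc 0 N, (((#{p ∈ S | p ∣ n} : ℝ) - A : ℝ) : ℂ) * (F n * ν n)‖ ≤
      √(N * (N * A + 2 * #S * A)) := by
    refine Real.le_sqrt_of_sq_le ((norm_sum_sq_le_card_mul _ _).trans ?_)
    rw [Nat.card_Ioc, tsub_zero]
    refine mul_le_mul_of_nonneg_left (le_trans (sum_le_sum fun n _ => ?_)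
      (turan_kubilius S hS N)) (Nat.cast_nonneg _)
    rw [norm_mul, mul_pow, Complex.norm_real, Real.norm_eq_abs, sq_abs]
    refine mul_le_of_le_one_right (sq_nonneg _) (pow_le_one₀ (norm_nonneg _) ?_)
    rw [norm_mul]
    exact mul_le_one₀ (hF _) (norm_nonneg _) (hν _)
  -- The number of primes of `S` dividing `n` is close to its mean `A` (Turán–Kubilius), so `A` may
  -- be replaced by this count; the weighted sum is then a sum over multiples, close to the bilinear
  -- sum `T`.
  have h4 : (A : ℂ) * ∑ n ∈ Ioc 0 N, F n * ν n =
      (∑ p ∈ S, ∑ n ∈ Ioc 0 N with p ∣ n, F n * ν n - T) + T -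
      ∑ n ∈ Ioc 0 N, (((#{p ∈ S | p ∣ n} : ℝ) - A : ℝ) : ℂ) * (F n * ν n) := by
    rw [← h1, mul_sum]
    simp only [Complex.ofReal_sub, sub_mul, sum_sub_distrib]
    ring
  have h5 : A * ‖∑ n ∈ Ioc 0 N, F n * ν n‖ = ‖(A : ℂ) * ∑ n ∈ Ioc 0 N, F n * ν n‖ := by
    rw [norm_mul, Complex.norm_real, Real.norm_of_nonneg hA0]
  rw [h5, h4]
  refine (norm_sub_le _ _).trans ?_
  have := norm_add_le (∑ p ∈ S, ∑ n ∈ Ioc 0 N with p ∣ n, F n * ν n - T) T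
  linarith

lemma exists_finset_primes_sum_one_div_gt (C : ℝ) :
    ∃ S : Finset ℕ, (∀ p ∈ S, p.Prime) ∧ C < ∑ p ∈ S, (1 / p : ℝ) := by
  by_contra! h
  refine Nat.Primes.not_summable_one_div (summable_of_sum_le (c := C)
    (fun p => by positivity) fun u => ?_)
  have := h (u.image fun p : Nat.Primes => (p : ℕ)) (fun p hp => by
    obtain ⟨q, _, rfl⟩ := Finset.mem_image.mp hp
    exact q.2)
  have himage := sum_image (s := u) (g := fun p : Nat.Primes => (p : ℕ))
    (f := fun n : ℕ => (1 / n : ℝ)) fun p _ q _ hpq => Nat.Primes.coe_nat_injective hpq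
  exact himage ▸ this

/-- **Kátai's orthogonality criterion**. -/
theorem katai_criterion {ν F : ℕ → ℂ} (hmul : ∀ m n : ℕ, m.Coprime n → ν (m * n) = ν m * ν n)
    (hν : ∀ n, ‖ν n‖ ≤ 1) (hF : ∀ n, ‖F n‖ ≤ 1)
    (hcorr : ∀ p q : ℕ, p.Prime → q.Prime → p ≠ q → Tendsto (fun N : ℕ =>
      ‖∑ m ∈ Ioc 0 N, F (p * m) * (starRingEnd ℂ) (F (q * m))‖ / N) atTop (𝓝 0)) :
    Tendsto (fun N : ℕ => ‖∑ n ∈ Ioc 0 N, F n * ν n‖ / N) atTop (𝓝 0) := by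
  -- `B` must not depend on `S`: after division by `A` the limiting bound is `2 / √A + 2 * B / A`,
  -- which is small once `S` makes `A` large.
  obtain ⟨B, hB⟩ : ∃ B : ℝ, ∀ S : Finset ℕ, ∑ p ∈ S, (1 / (p : ℝ) ^ 2) ≤ B :=
    ⟨_, fun S => (Real.summable_one_div_nat_pow.mpr one_lt_two).sum_le_tsum S
      fun _ _ => by positivity⟩
  have hlim : Tendsto (fun A : ℝ => 2 * (√A)⁻¹ + 2 * B * A⁻¹) atTop (𝓝 0) := by
    have h1 := (Real.tendsto_sqrt_atTop.inv_tendsto_atTop).const_mul 2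
    have h2 := (tendsto_inv_atTop_zero (𝕜 := ℝ)).const_mul (2 * B)
    simpa using h1.add h2
  refine tendsto_order.mpr ⟨fun a ha => Eventually.of_forall fun N => ha.trans_le (by positivity),
    fun ε hε => ?_⟩
  obtain ⟨C, hC⟩ := eventually_atTop.mp (hlim.eventually (gt_mem_nhds hε))
  obtain ⟨S, hS, hCS⟩ := exists_finset_primes_sum_one_div_gt (max C 0)
  set A := ∑ p ∈ S, (1 / p : ℝ) with hA
  have hA0 : 0 < A := (le_max_right _ _).trans_lt hCS
  have hAε := hC A ((le_max_left _ _).trans hCS.le)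
  set R : ℕ → ℝ := fun N => ∑ p ∈ S, ∑ q ∈ S with p ≠ q,
    ‖∑ m ∈ Ioc 0 (N / max p q), F (p * m) * (starRingEnd ℂ) (F (q * m))‖ with hR
  have hRlim : Tendsto (fun N : ℕ => R N / N) atTop (𝓝 0) := by
    simp only [hR, sum_div]
    rw [show (0 : ℝ) = ∑ p ∈ S, ∑ q ∈ S with p ≠ q, 0 by simp]
    refine tendsto_finsetSum _ fun p hp => tendsto_finsetSum _ fun q hq => ?_
    simp only [mem_filter] at hq
    have hm : 0 < max p q := lt_max_of_lt_left (hS p hp).pos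
    refine squeeze_zero (fun N => by positivity) (fun N => ?_)
      ((hcorr p q (hS p hp) (hS q hq.1) hq.2).comp (Nat.tendsto_div_const_atTop hm.ne'))
    simp only [Function.comp]
    rcases Nat.eq_zero_or_pos (N / max p q) with h0 | h0
    · simp [h0]
    · gcongr
      exact Nat.div_le_self _ _
  have hmain : Tendsto (fun N : ℕ => (√(A + 2 * #S * A / N) + 2 * B + √(A + R N / N)) / A)
      atTop (𝓝 ((√(A + 0) + 2 * B + √(A + 0)) / A)) := by
    refine Tendsto.div_const (Tendsto.add (Tendsto.add ?_ tendsto_const_nhds) ?_) _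
    · exact (tendsto_const_nhds.add (tendsto_const_div_atTop_nhds_zero_nat _)).sqrt
    · exact (tendsto_const_nhds.add hRlim).sqrt
  have hval : (√(A + 0) + 2 * B + √(A + 0)) / A = 2 * (√A)⁻¹ + 2 * B * A⁻¹ := by
    have : √A / A = (√A)⁻¹ := by rw [Real.sqrt_div_self]
    rw [add_zero, ← this]
    ring
  rw [hval] at hmain
  filter_upwards [hmain.eventually (gt_mem_nhds hAε), eventually_gt_atTop 0] with N hN hN0
  refine lt_of_le_of_lt ?_ hN
  have hNpos : (0 : ℝ) < N := by exact_mod_cast hN0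
  have key := katai_inequality hmul hν hF S hS N
  have hs : ∀ x : ℝ, √(N * (N * A + x)) = N * √(A + x / N) := fun x => by
    rw [show (N : ℝ) * (N * A + x) = N ^ 2 * (A + x / N) by field_simp,
      Real.sqrt_mul (by positivity), Real.sqrt_sq hNpos.le]
  rw [← hA, hs, hs] at key
  have hBN : 2 * (N : ℝ) * ∑ p ∈ S, (1 / (p : ℝ) ^ 2) ≤ 2 * N * B := by
    gcongr
    exact hB S
  rw [div_le_div_iff₀ hNpos hA0]
  simp only [hR]
  linarith

/-! ### Slowly varying weights. -/

/-- A sequence is slowly varying if its total variation up to `N` is `o(N)`. -/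
def SlowlyVarying (w : ℕ → ℂ) : Prop :=
  Tendsto (fun N : ℕ => (∑ n ∈ range N, ‖w (n + 1) - w n‖) / N) atTop (𝓝 0)

lemma norm_add_sub_le_sum (w : ℕ → ℂ) (a l : ℕ) :
    ‖w (a + l) - w a‖ ≤ ∑ j ∈ range l, ‖w (a + j + 1) - w (a + j)‖ := by
  have := sum_range_sub (fun j => w (a + j)) l
  rw [add_zero] at this
  rw [← this]
  exact norm_sum_le _ _

namespace SlowlyVarying

variable {w v : ℕ → ℂ}

lemma star (hw : SlowlyVarying w) : SlowlyVarying fun n => (starRingEnd ℂ) (w n) := by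
  simpa only [SlowlyVarying, ← map_sub, RCLike.norm_conj] using hw

lemma mul (hw : SlowlyVarying w) (hv : SlowlyVarying v) (hw1 : ∀ n, ‖w n‖ ≤ 1)
    (hv1 : ∀ n, ‖v n‖ ≤ 1) : SlowlyVarying fun n => w n * v n := by
  have h := Tendsto.add hw hv
  rw [add_zero] at h
  refine squeeze_zero (fun N => by positivity) (fun N => ?_) h
  rw [← add_div, ← sum_add_distrib]
  gcongr with n _
  rw [show w (n + 1) * v (n + 1) - w n * v n =
    (w (n + 1) - w n) * v (n + 1) + w n * (v (n + 1) - v n) by ring]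
  refine (norm_add_le _ _).trans ?_
  rw [norm_mul, norm_mul]
  exact add_le_add (mul_le_of_le_one_right (norm_nonneg _) (hv1 _))
    (mul_le_of_le_one_left (norm_nonneg _) (hw1 _))

/-- By the triangle inequality, the variation of the dilate up to `N` is at most that of `w` up to
`p * N`, and `p` is fixed. -/
lemma dilate (hw : SlowlyVarying w) {p : ℕ} (hp : 0 < p) : SlowlyVarying fun n => w (p * n) := by
  have h := (hw.comp (tendsto_id.const_mul_atTop' hp)).const_mul (p : ℝ)
  rw [mul_zero] at h
  refine squeeze_zero (fun N => by positivity) (fun N => ?_) h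
  have hp0 : (p : ℝ) ≠ 0 := by exact_mod_cast hp.ne'
  simp only [Function.comp, id, Nat.cast_mul]
  rw [mul_div_assoc', mul_div_mul_left _ _ hp0]
  gcongr
  induction N with
  | zero => simp
  | succ N ih =>
    rw [sum_range_succ, mul_add, mul_one, sum_range_add]
    exact add_le_add ih (norm_add_sub_le_sum w (p * N) p)

/-- Exponential sums with an irrational top difference are orthogonal to slowly varying
sequences. -/
theorem tendsto_sum_mul_phase (hw : SlowlyVarying w) (hw1 : ∀ n, ‖w n‖ ≤ 1) {f : ℝ → ℝ} {β : ℝ}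
    {d : ℕ} (hβ : Irrational β) (hf : ∀ x, (fwdDiff 1)^[d + 1] f x = β) :
    Tendsto (fun N : ℕ => ‖∑ n ∈ range N, w n * phase (f n)‖ / N) atTop (𝓝 0) := by
  refine tendsto_order.mpr ⟨fun a ha => Eventually.of_forall fun N => ha.trans_le (by positivity),
    fun ε hε => ?_⟩
  obtain ⟨L₀, hL₀⟩ := weyl_sum_le d hβ (half_pos hε)
  set L := L₀ + 1
  have hL : (0 : ℝ) < L := by positivity
  -- Translates of `f` have the same top difference, so one window length `L` serves every starting
  -- point.
  have hweyl : ∀ n : ℕ, ‖∑ l ∈ range L, phase (f (n + l : ℕ))‖ ≤ ε / 2 * L := fun n => by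
    have := hL₀ L (by omega) (fun x => f (x + n)) fun x => by
      rw [fwdDiff_iter_comp_add]; exact hf _
    simpa [add_comm] using this
  set V : ℕ → ℝ := fun N => ∑ n ∈ range N, ‖w (n + 1) - w n‖ with hV
  have hdiff : ∀ n, ‖w (n + 1) - w n‖ ≤ 2 := fun n =>
    (norm_sub_le _ _).trans (by linarith [hw1 (n + 1), hw1 n])
  have hVshift : ∀ N, ∀ j < L, ∑ n ∈ range N, ‖w (n + j + 1) - w (n + j)‖ ≤ V N + 2 * L := by
    intro N j hj
    have h1 := sum_range_add (fun n => ‖w (n + 1) - w n‖) j N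
    rw [add_comm j N, sum_range_add] at h1
    have h2 : ∑ x ∈ range j, ‖w (N + x + 1) - w (N + x)‖ ≤ ∑ x ∈ range j, (2 : ℝ) :=
      sum_le_sum fun x _ => hdiff _
    have h3 : 0 ≤ ∑ x ∈ range j, ‖w (x + 1) - w x‖ := by positivity
    have h4 : (j : ℝ) ≤ L := by exact_mod_cast hj.le
    simp only [sum_const, card_range, nsmul_eq_mul] at h2
    simp only [hV, add_comm _ j] at h1 ⊢
    linarith
  have hbound : ∀ N : ℕ, ‖∑ n ∈ range N, w n * phase (f n)‖ ≤
      ε / 2 * N + L * V N + (2 * L ^ 2 + 2 * L) := by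
    intro N
    have h1 := mul_norm_sum_range_le (u := fun n => w n * phase (f n))
      (fun n => by rw [norm_mul, norm_phase, mul_one]; exact hw1 n) N L
    have h2 : ∀ n ∈ range N, ‖∑ l ∈ range L, w (n + l) * phase (f (n + l : ℕ))‖ ≤
        ε / 2 * L + L * ∑ j ∈ range L, ‖w (n + j + 1) - w (n + j)‖ := by
      intro n _
      -- The weight is frozen at the start of the window; the error is its variation there.
      have h3 : ∑ l ∈ range L, w (n + l) * phase (f (n + l : ℕ)) =
          w n * ∑ l ∈ range L, phase (f (n + l : ℕ)) +
          ∑ l ∈ range L, (w (n + l) - w n) * phase (f (n + l : ℕ)) := by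
        rw [mul_sum, ← sum_add_distrib]
        exact sum_congr rfl fun l _ => by ring
      rw [h3]
      refine (norm_add_le _ _).trans (add_le_add ?_ ?_)
      · rw [norm_mul]
        exact (mul_le_of_le_one_left (norm_nonneg _) (hw1 n)).trans (hweyl n)
      · refine (norm_sum_le_of_le (range L)
          (n := fun _ => ∑ j ∈ range L, ‖w (n + j + 1) - w (n + j)‖) fun l hl => ?_).trans
          (by simp)
        rw [norm_mul, norm_phase, mul_one]
        exact (norm_add_sub_le_sum w n l).trans (sum_le_sum_of_subset_of_nonneg
          (range_subset_range.mpr (mem_range.mp hl).le) fun _ _ _ => norm_nonneg _)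
    have h4 : ‖∑ n ∈ range N, ∑ l ∈ range L, w (n + l) * phase (f (n + l : ℕ))‖ ≤
        N * (ε / 2 * L) + L * (L * (V N + 2 * L)) := by
      refine (norm_sum_le_of_le _ h2).trans ?_
      rw [sum_add_distrib, sum_const, card_range, nsmul_eq_mul, ← mul_sum, sum_comm]
      gcongr
      calc _ ≤ ∑ j ∈ range L, (V N + 2 * L) :=
            sum_le_sum fun j hj => hVshift N j (mem_range.mp hj)
        _ = _ := by simp [mul_add]
    have h5 : L * ‖∑ n ∈ range N, w n * phase (f n)‖ ≤
        L * (ε / 2 * N + L * V N + (2 * L ^ 2 + 2 * L)) := by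
      refine (h1.trans (add_le_add_left h4 _)).trans (le_of_eq ?_)
      ring
    exact le_of_mul_le_mul_left h5 hL
  have hlim : Tendsto (fun N : ℕ => ε / 2 + L * (V N / N) + (2 * L ^ 2 + 2 * L : ℝ) / N) atTop
      (𝓝 (ε / 2 + L * 0 + 0)) :=
    (tendsto_const_nhds.add (hw.const_mul _)).add (tendsto_const_div_atTop_nhds_zero_nat _)
  filter_upwards [hlim.eventually (gt_mem_nhds (show ε / 2 + L * 0 + 0 < ε by linarith)),
    eventually_gt_atTop 0] with N hN hN0
  refine lt_of_le_of_lt ?_ hN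
  have hNpos : (0 : ℝ) < N := by exact_mod_cast hN0
  rw [div_le_iff₀ hNpos]
  refine (hbound N).trans (le_of_eq ?_)
  field_simp

end SlowlyVarying

lemma sum_Ioc_zero_eq_sum_range {E : Type*} [AddCommMonoid E] (h : ℕ → E) (N : ℕ) :
    ∑ n ∈ Ioc 0 N, h n = ∑ n ∈ range N, h (n + 1) := by
  induction N with
  | zero => simp
  | succ N ih => rw [sum_Ioc_succ_top (Nat.zero_le N), ih, sum_range_succ]

/-! ### Dilates of the polynomial. -/

/-- The top difference of `P(px) - P(qx)` is an irrational constant. -/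
lemma exists_irrational_fwdDiff_dilate_sub {P : Polynomial ℝ} (hdeg : 0 < P.natDegree)
    (hP : Irrational P.leadingCoeff) {p q : ℕ} (hpq : p ≠ q) :
    ∃ β : ℝ, Irrational β ∧
      ∀ x, (fwdDiff 1)^[P.natDegree] (fun y : ℝ => P.eval (p * y) - P.eval (q * y)) x = β := by
  set d := P.natDegree with hd
  set Q : Polynomial ℝ := P.comp (.C (p : ℝ) * .X) - P.comp (.C (q : ℝ) * .X) with hQ
  have hcoeff : Q.coeff d = (((p : ℤ) ^ d - (q : ℤ) ^ d : ℤ) : ℝ) * P.leadingCoeff := by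
    rw [hQ, Polynomial.coeff_sub, Polynomial.comp_C_mul_X_coeff, Polynomial.comp_C_mul_X_coeff,
      Polynomial.leadingCoeff, ← hd]
    push_cast
    ring
  -- Positivity of the degree is essential here: for `d = 0` the two powers coincide.
  have hne : ((p : ℤ) ^ d - (q : ℤ) ^ d : ℤ) ≠ 0 := by
    rw [sub_ne_zero]
    exact_mod_cast fun h => hpq (Nat.pow_left_injective hdeg.ne' h)
  have hirr : Irrational (Q.coeff d) := hcoeff ▸ hP.intCast_mul hne
  have hcomp : ∀ r : ℝ, (P.comp (.C r * .X)).natDegree ≤ d := fun r => by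
    refine Polynomial.natDegree_comp_le.trans ?_
    exact (Nat.mul_le_mul_left _ ((Polynomial.natDegree_C_mul_le r _).trans Polynomial.natDegree_X_le)).trans (mul_one _).le
  have hQd : Q.natDegree = d := Polynomial.natDegree_eq_of_le_of_coeff_ne_zero
    ((Polynomial.natDegree_sub_le_of_le (hcomp _) (hcomp _)).trans (max_self d).le) hirr.ne_zero
  have hQlead : Q.leadingCoeff = Q.coeff d := by rw [Polynomial.leadingCoeff, hQd]
  refine ⟨Q.coeff d * d.factorial, hirr.mul_natCast (Nat.factorial_ne_zero d), fun x => ?_⟩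
  have h := congrFun Q.fwdDiff_iter_degree_eq_factorial x
  rw [hQd, hQlead] at h
  have hfun : (fun y : ℝ => P.eval (p * y) - P.eval (q * y)) = fun y => Q.eval y := by
    ext y; simp [hQ]
  rw [hfun, h]
  simp

/-! ### Blocks and their indices. -/

section Blocks

variable {b : ℕ → ℕ}

/-- The index `k` of the block `[b k, b (k + 1))` containing `n`. -/
def blockIndex (b : ℕ → ℕ) (n : ℕ) : ℕ := Nat.findGreatest (fun k => b k ≤ n) n

lemma blockIndex_mono (b : ℕ → ℕ) : Monotone (blockIndex b) := fun _ _ h =>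
  Nat.findGreatest_mono (fun _ hk => le_trans hk h) h

lemma le_of_blocks (hb1 : b 1 = 1) (hb : ∀ k : ℕ, 1 ≤ k → b k < b (k + 1)) {k : ℕ} (hk : 1 ≤ k) :
    k ≤ b k := by
  induction k, hk using Nat.le_induction with
  | base => rw [hb1]
  | succ k hk ih => exact lt_of_le_of_lt ih (hb k hk)

lemma mono_of_blocks (hb : ∀ k : ℕ, 1 ≤ k → b k < b (k + 1)) {k l : ℕ} (hk : 1 ≤ k) (hkl : k ≤ l) :
    b k ≤ b l := by
  induction l, hkl using Nat.le_induction with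
  | base => rfl
  | succ l hl ih => exact ih.trans (hb l (hk.trans hl)).le

lemma blockIndex_eq (hb1 : b 1 = 1) (hb : ∀ k : ℕ, 1 ≤ k → b k < b (k + 1)) {k n : ℕ}
    (hk : 1 ≤ k) (hn : n ∈ Ico (b k) (b (k + 1))) : blockIndex b n = k := by
  rw [mem_Ico] at hn
  -- The search bound `n` in `blockIndex` loses nothing, because `k ≤ b k ≤ n`.
  refine Nat.findGreatest_eq_iff.mpr ⟨(le_of_blocks hb1 hb hk).trans hn.1, fun _ => hn.1,
    fun j hj _ h => ?_⟩
  exact absurd (mono_of_blocks hb (Nat.le_add_left 1 k) (Nat.succ_le_of_lt hj)) (by omega)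

/-- From some `K₀` on every gap is at least `G`, so `b` grows at rate at least `G`. As `G` is
arbitrary, the number of blocks up to `N` is `o(N)`. -/
lemma mul_blockIndex_le
    (hgap : Tendsto (fun k : ℕ => (b (k + 1) : ℤ) - (b k : ℤ)) atTop atTop) (G : ℕ) :
    ∃ K₀ : ℕ, ∀ N, G * blockIndex b N ≤ N + G * K₀ := by
  obtain ⟨K₀, hK₀⟩ := eventually_atTop.mp (hgap.eventually_ge_atTop (G : ℤ))
  have hlow : ∀ j, G * j ≤ b (K₀ + j) := by
    intro j
    induction j with
    | zero => simp
    | succ j ih =>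
      have := hK₀ (K₀ + j) (Nat.le_add_right _ _)
      rw [mul_add, mul_one, ← add_assoc]
      omega
  refine ⟨K₀, fun N => ?_⟩
  rcases le_or_gt (blockIndex b N) K₀ with h | h
  · exact (Nat.mul_le_mul_left G h).trans (Nat.le_add_left _ _)
  · obtain ⟨j, hj⟩ := Nat.exists_eq_add_of_le h.le
    have h1 : b (blockIndex b N) ≤ N :=
      Nat.findGreatest_of_ne_zero (P := fun k => b k ≤ N) (n := N) rfl (by omega)
    have h2 := hlow j
    rw [← hj] at h2
    rw [hj, mul_add]
    omega

/-- A bounded sequence that is constant on blocks of length tending to infinity varies slowly. -/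
lemma slowlyVarying_comp_blockIndex
    (hgap : Tendsto (fun k : ℕ => (b (k + 1) : ℤ) - (b k : ℤ)) atTop atTop)
    {c : ℕ → ℂ} (hc : ∀ k, ‖c k‖ ≤ 1) : SlowlyVarying fun n => c (blockIndex b n) := by
  -- Each jump costs at most `2` and raises the block index by at least one.
  have hvar : ∀ N, ∑ n ∈ range N, ‖c (blockIndex b (n + 1)) - c (blockIndex b n)‖ ≤
      2 * blockIndex b N := by
    intro N
    induction N with
    | zero => simp
    | succ N ih =>
      rw [sum_range_succ]
      rcases (blockIndex_mono b (Nat.le_succ N)).eq_or_lt with h | h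
      · rw [Nat.succ_eq_add_one] at h
        rw [← h, sub_self, norm_zero, add_zero]
        exact ih
      · have h1 : ‖c (blockIndex b (N + 1)) - c (blockIndex b N)‖ ≤ 2 :=
          (norm_sub_le _ _).trans (by linarith [hc (blockIndex b (N + 1)), hc (blockIndex b N)])
        have h2 : (blockIndex b N : ℝ) + 1 ≤ blockIndex b (N + 1) := by exact_mod_cast h
        linarith
  refine tendsto_order.mpr ⟨fun a ha => Eventually.of_forall fun N => ha.trans_le (by positivity),
    fun ε hε => ?_⟩
  -- In `2 * G * blockIndex b N ≤ 2 * N + 2 * G * K₀`, the choices of `G` and `M` make each term on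
  -- the right less than `G * ε * N / 2`.
  obtain ⟨G, hG⟩ := exists_nat_gt (4 / ε)
  have hG0 : (0 : ℝ) < G := lt_trans (by positivity) hG
  obtain ⟨K₀, hK₀⟩ := mul_blockIndex_le hgap G
  obtain ⟨M, hM⟩ := exists_nat_gt (4 * K₀ / ε)
  filter_upwards [eventually_gt_atTop M] with N hN
  have hMN : (M : ℝ) < N := by exact_mod_cast hN
  have hN0 : (0 : ℝ) < N := lt_of_le_of_lt (Nat.cast_nonneg M) hMN
  rw [div_lt_iff₀ hN0]
  refine (hvar N).trans_lt ?_
  rw [div_lt_iff₀ hε] at hG hM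
  have h1 : (G : ℝ) * blockIndex b N ≤ N + G * K₀ := by exact_mod_cast hK₀ N
  have h2 : (4 * K₀ : ℝ) < N * ε := hM.trans (by gcongr)
  have h3 : (G : ℝ) * (2 * blockIndex b N) < G * (ε * N) := by nlinarith
  exact lt_of_mul_lt_mul_left h3 hG0.le

lemma sum_Ioc_eq_sum_blocks {E : Type*} [AddCommMonoid E] (hb1 : b 1 = 1)
    (hb : ∀ k : ℕ, 1 ≤ k → b k < b (k + 1)) (h : ℕ → E) (K : ℕ) :
    ∑ n ∈ Ioc 0 (b (K + 1) - 1), h n =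
      ∑ k ∈ Icc 1 K, ∑ n ∈ Ico (b k) (b (k + 1)), h n := by
  have hset : Ioc 0 (b (K + 1) - 1) = Ico 1 (b (K + 1)) := by
    ext n; simp only [mem_Ioc, mem_Ico]; omega
  rw [hset]
  clear hset
  induction K with
  | zero => simp [hb1]
  | succ K ih =>
    rw [sum_Icc_succ_top (by omega), ← ih, sum_Ico_consecutive]
    · exact (Nat.le_add_left 1 K).trans (le_of_blocks hb1 hb (Nat.le_add_left 1 K))
    · exact (hb _ (Nat.le_add_left 1 K)).le

end Blocks

/-! ### Correlations and conclusion. -/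

/-- Distinct dilates of a block-modulated polynomial phase are asymptotically orthogonal. -/
lemma tendsto_correlation_blockPhase {w : ℕ → ℂ} (hw : SlowlyVarying w) (hw1 : ∀ n, ‖w n‖ ≤ 1)
    {P : Polynomial ℝ} (hdeg : 0 < P.natDegree) (hP : Irrational P.leadingCoeff) {p q : ℕ}
    (hp : 0 < p) (hq : 0 < q) (hpq : p ≠ q) :
    Tendsto (fun N : ℕ => ‖∑ m ∈ Ioc 0 N, w (p * m) * phase (P.eval ((p * m : ℕ) : ℝ)) *
      (starRingEnd ℂ) (w (q * m) * phase (P.eval ((q * m : ℕ) : ℝ)))‖ / N) atTop (𝓝 0) := by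
  obtain ⟨β, hβ, hf⟩ := exists_irrational_fwdDiff_dilate_sub hdeg hP hpq
  obtain ⟨d, hd⟩ : ∃ d, P.natDegree = d + 1 := ⟨_, (Nat.succ_pred_eq_of_pos hdeg).symm⟩
  rw [hd] at hf
  set f : ℝ → ℝ := fun y => P.eval (p * y) - P.eval (q * y) with hfdef
  set v : ℕ → ℂ := fun n => w (p * n) * (starRingEnd ℂ) (w (q * n)) with hv
  have hv1 : ∀ n, ‖v n‖ ≤ 1 := fun n => by
    rw [norm_mul, RCLike.norm_conj]; exact mul_le_one₀ (hw1 _) (norm_nonneg _) (hw1 _)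
  have hvs : SlowlyVarying v := (hw.dilate hp).mul (hw.dilate hq).star (fun n => hw1 _)
    fun n => by rw [RCLike.norm_conj]; exact hw1 _
  have hterm : ∀ m : ℕ, w (p * m) * phase (P.eval ((p * m : ℕ) : ℝ)) *
      (starRingEnd ℂ) (w (q * m) * phase (P.eval ((q * m : ℕ) : ℝ))) = v m * phase (f m) := by
    intro m
    simp only [hv, hfdef, map_mul, ← phase_mul_conj_phase]
    push_cast
    ring
  simp_rw [hterm]
  -- The extra `2 / N` pays for passing from indices `1, ..., N` to `0, ..., N - 1`.
  have h := (hvs.tendsto_sum_mul_phase hv1 hβ hf).add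
    (tendsto_const_div_atTop_nhds_zero_nat (2 : ℝ))
  rw [add_zero] at h
  refine squeeze_zero (fun N => by positivity) (fun N => ?_) h
  rw [← add_div, sum_Ioc_zero_eq_sum_range]
  gcongr
  have hshift := norm_sum_range_shift_sub_le (u := fun n => v n * phase (f n))
    (fun n => by rw [norm_mul, norm_phase, mul_one]; exact hv1 n) N 1
  rw [norm_sub_rev] at hshift
  have := norm_sub_norm_le (∑ n ∈ range N, v (n + 1) * phase (f (n + 1 : ℕ)))
    (∑ n ∈ range N, v n * phase (f n))
  simp only [Nat.cast_one, mul_one] at hshift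
  linarith

theorem theorem4
    (ν : ArithmeticFunction ℂ) (hν : ν.IsMultiplicative) (hν1 : ∀ n : ℕ, 1 ≤ n → ‖ν n‖ ≤ 1)
    (b : ℕ → ℕ) (hb1 : b 1 = 1) (hb : ∀ k : ℕ, 1 ≤ k → b k < b (k + 1))
    (hgap : Filter.Tendsto (fun k : ℕ => (b (k + 1) : ℤ) - (b k : ℤ)) Filter.atTop Filter.atTop)
    (P : Polynomial ℝ) (hdeg : 0 < P.natDegree) (hP : Irrational P.leadingCoeff) :
    Filter.Tendsto
      (fun K : ℕ => (1 / (b (K + 1) : ℝ)) *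
        ∑ k ∈ Finset.Icc 1 K,
          ‖∑ n ∈ Finset.Ico (b k) (b (k + 1)),
            Complex.exp (2 * (Real.pi : ℂ) * Complex.I * ((P.eval (n : ℝ) : ℝ) : ℂ)) * ν n‖)
      Filter.atTop (nhds 0) := by
  have hνall : ∀ n, ‖ν n‖ ≤ 1 := fun n => by
    rcases Nat.eq_zero_or_pos n with rfl | h
    · simp
    · exact hν1 n h
  set s : ℕ → ℂ := fun k => ∑ n ∈ Ico (b k) (b (k + 1)), phase (P.eval (n : ℝ)) * ν n with hs
  -- If `s k = 0`, division by zero gives `c k = 0`, and both `‖c k‖ ≤ 1` and `c k * s k = ‖s k‖`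
  -- still hold.
  set c : ℕ → ℂ := fun k => (starRingEnd ℂ) (s k) / ‖s k‖ with hc
  have hc1 : ∀ k, ‖c k‖ ≤ 1 := fun k => by
    rw [hc, norm_div, RCLike.norm_conj, Complex.norm_real, norm_norm]
    exact div_self_le_one _
  have hcs : ∀ k, c k * s k = (‖s k‖ : ℂ) := fun k => by
    rw [hc, div_mul_eq_mul_div, Complex.conj_mul', sq, mul_self_div_self]
  set w : ℕ → ℂ := fun n => c (blockIndex b n) with hw
  have hw1 : ∀ n, ‖w n‖ ≤ 1 := fun n => hc1 _
  have hkatai := katai_criterion (ν := ν) (F := fun n => w n * phase (P.eval (n : ℝ)))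
    (fun m n h => hν.map_mul_of_coprime h) hνall
    (fun n => by rw [norm_mul, norm_phase, mul_one]; exact hw1 n)
    (fun p q hp hq hpq => tendsto_correlation_blockPhase
      (slowlyVarying_comp_blockIndex hgap hc1) hw1 hdeg hP hp.pos hq.pos hpq)
  have hsum : ∀ K, ∑ n ∈ Ioc 0 (b (K + 1) - 1), w n * phase (P.eval (n : ℝ)) * ν n =
      ((∑ k ∈ Icc 1 K, ‖s k‖ : ℝ) : ℂ) := fun K => by
    rw [sum_Ioc_eq_sum_blocks hb1 hb, Complex.ofReal_sum]
    refine sum_congr rfl fun k hk => ?_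
    rw [← hcs, hs, mul_sum]
    refine sum_congr rfl fun n hn => ?_
    rw [hw]
    simp only [blockIndex_eq hb1 hb (mem_Icc.mp hk).1 hn]
    ring
  have hbtop : Tendsto (fun K => b (K + 1) - 1) atTop atTop :=
    tendsto_atTop_mono (fun K => by
      have := le_of_blocks hb1 hb (Nat.le_add_left 1 K)
      show K ≤ b (K + 1) - 1
      omega) tendsto_id
  refine squeeze_zero (fun K => by positivity) (fun K => ?_) (hkatai.comp hbtop)
  change 1 / (b (K + 1) : ℝ) * ∑ k ∈ Icc 1 K, ‖s k‖ ≤ _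
  simp only [Function.comp]
  have h0 : 0 ≤ ∑ k ∈ Icc 1 K, ‖s k‖ := by positivity
  -- The criterion normalises by `b (K + 1) - 1`, which gives a larger quotient when positive; when
  -- it is zero the sum is empty.
  rcases Nat.eq_zero_or_pos (b (K + 1) - 1) with h | h
  · have h2 := hsum K
    rw [h, Ioc_self, sum_empty] at h2
    have h3 : ∑ k ∈ Icc 1 K, ‖s k‖ = 0 := by exact_mod_cast h2.symm
    rw [h3, mul_zero]
    positivity
  · rw [hsum, Complex.norm_real, Real.norm_of_nonneg h0, one_div_mul_eq_div]
    gcongr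
    exact Nat.sub_le _ _
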